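/- Let $\mathfrak S=\operatorname{span}_{\mathbb C}\{e,h,f,p,q,z\}$ be the Schrödinger algebra, the complex Lie algebra with brackets $[h,e]=2e$, $[h,f]=-2f$, $[e,f]=h$, $[h,p]=p$, $[h,q]=-q$, $[p,q]=z$, $[e,q]=p$, $[p,f]=-q$, $[f,q]=0$, $[e,p]=0$, $[z,\mathfrak S]=0$, and let $\mathcal H=\operatorname{span}_{\mathbb C}\{p,q,z\}$ be its Heisenberg subalgebra. Let $\phi:\mathcal H\to\mathbb C$ be a nonzero Lie algebra homomorphism. Let $V$ be a quasi-Whittaker module of type $\phi$ with cyclic quasi-Whittaker vector $w$, i.e. $V$ is an $\mathfrak S$-module, $0\neq w\in V$, $xw=\phi(x)w$ for all $x\in\mathcal H$, and $V=U(\mathfrak S)w$. Put $C_0=p^2f-q^2e-hpq\in U(\mathfrak S)$, and let $\mathbb C[C_0]$ be the subalgebra of $U(\mathfrak S)$ generated by $C_0$. For $A=\mathbb C[C_0]$ or $A=U(\mathfrak S)$ write $\operatorname{Ann}_A(w)=\{a\in A: aw=0\}$. Suppose that $\operatorname{Ann}_{\mathbb C[C_0]}(w)\neq 0$ and that $d\in\mathbb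 C[x]$ is a monic polynomial such that $d(C_0)$ generates the ideal $\operatorname{Ann}_{\mathbb C[C_0]}(w)$ of $\mathbb C[C_0]$. Then $$\operatorname{Ann}_{U(\mathfrak S)}(w)=U(\mathfrak S)\,d(C_0)+U(\mathfrak S)\,(p-\phi(p)1)+U(\mathfrak S)\,(q-\phi(q)1).$$ -/

import Mathlib

/-- The Schrödinger algebra `𝔖`: the six-dimensional complex vector space with basis
`e, h, f, p, q, z`, an element being recorded by its six coordinates. -/
@[ext]
structure SchrodingerAlgebra where
  /-- coordinate of `e` -/
  ce : ℂ
  /-- coordinate of `h` -/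
  ch : ℂ
  /-- coordinate of `f` -/
  cf : ℂ
  /-- coordinate of `p` -/
  cp : ℂ
  /-- coordinate of `q` -/
  cq : ℂ
  /-- coordinate of `z` -/
  cz : ℂ

namespace SchrodingerAlgebra

noncomputable section

instance : Zero SchrodingerAlgebra := ⟨⟨0, 0, 0, 0, 0, 0⟩⟩

instance : Add SchrodingerAlgebra :=
  ⟨fun x y => ⟨x.ce + y.ce, x.ch + y.ch, x.cf + y.cf, x.cp + y.cp, x.cq + y.cq, x.cz + y.cz⟩⟩

instance : Neg SchrodingerAlgebra :=
  ⟨fun x => ⟨-x.ce, -x.ch, -x.cf, -x.cp, -x.cq, -x.cz⟩⟩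

instance : SMul ℂ SchrodingerAlgebra :=
  ⟨fun c x => ⟨c * x.ce, c * x.ch, c * x.cf, c * x.cp, c * x.cq, c * x.cz⟩⟩

/-- The bilinear alternating bracket determined by
`[h,e] = 2e`, `[h,f] = -2f`, `[e,f] = h`, `[h,p] = p`, `[h,q] = -q`, `[p,q] = z`,
`[e,q] = p`, `[p,f] = -q`, `[f,q] = 0`, `[e,p] = 0`, `[z,𝔖] = 0`
(see `bracket_table`). -/
instance : Bracket SchrodingerAlgebra SchrodingerAlgebra :=
  ⟨fun x y =>
    { ce := 2 * (x.ch * y.ce - x.ce * y.ch)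
      ch := x.ce * y.cf - x.cf * y.ce
      cf := -2 * (x.ch * y.cf - x.cf * y.ch)
      cp := (x.ch * y.cp - x.cp * y.ch) + (x.ce * y.cq - x.cq * y.ce)
      cq := -(x.ch * y.cq - x.cq * y.ch) - (x.cp * y.cf - x.cf * y.cp)
      cz := x.cp * y.cq - x.cq * y.cp }⟩

@[simp] lemma zero_ce : (0 : SchrodingerAlgebra).ce = 0 := rfl
@[simp] lemma zero_ch : (0 : SchrodingerAlgebra).ch = 0 := rfl
@[simp] lemma zero_cf : (0 : SchrodingerAlgebra).cf = 0 := rfl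
@[simp] lemma zero_cp : (0 : SchrodingerAlgebra).cp = 0 := rfl
@[simp] lemma zero_cq : (0 : SchrodingerAlgebra).cq = 0 := rfl
@[simp] lemma zero_cz : (0 : SchrodingerAlgebra).cz = 0 := rfl

@[simp] lemma add_ce (x y : SchrodingerAlgebra) : (x + y).ce = x.ce + y.ce := rfl
@[simp] lemma add_ch (x y : SchrodingerAlgebra) : (x + y).ch = x.ch + y.ch := rfl
@[simp] lemma add_cf (x y : SchrodingerAlgebra) : (x + y).cf = x.cf + y.cf := rfl
@[simp] lemma add_cp (x y : SchrodingerAlgebra) : (x + y).cp = x.cp + y.cp := rfl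
@[simp] lemma add_cq (x y : SchrodingerAlgebra) : (x + y).cq = x.cq + y.cq := rfl
@[simp] lemma add_cz (x y : SchrodingerAlgebra) : (x + y).cz = x.cz + y.cz := rfl

@[simp] lemma neg_ce (x : SchrodingerAlgebra) : (-x).ce = -x.ce := rfl
@[simp] lemma neg_ch (x : SchrodingerAlgebra) : (-x).ch = -x.ch := rfl
@[simp] lemma neg_cf (x : SchrodingerAlgebra) : (-x).cf = -x.cf := rfl
@[simp] lemma neg_cp (x : SchrodingerAlgebra) : (-x).cp = -x.cp := rfl
@[simp] lemma neg_cq (x : SchrodingerAlgebra) : (-x).cq = -x.cq := rfl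
@[simp] lemma neg_cz (x : SchrodingerAlgebra) : (-x).cz = -x.cz := rfl

@[simp] lemma smul_ce (c : ℂ) (x : SchrodingerAlgebra) : (c • x).ce = c * x.ce := rfl
@[simp] lemma smul_ch (c : ℂ) (x : SchrodingerAlgebra) : (c • x).ch = c * x.ch := rfl
@[simp] lemma smul_cf (c : ℂ) (x : SchrodingerAlgebra) : (c • x).cf = c * x.cf := rfl
@[simp] lemma smul_cp (c : ℂ) (x : SchrodingerAlgebra) : (c • x).cp = c * x.cp := rfl
@[simp] lemma smul_cq (c : ℂ) (x : SchrodingerAlgebra) : (c • x).cq = c * x.cq := rfl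
@[simp] lemma smul_cz (c : ℂ) (x : SchrodingerAlgebra) : (c • x).cz = c * x.cz := rfl

@[simp] lemma lie_ce (x y : SchrodingerAlgebra) :
    ⁅x, y⁆.ce = 2 * (x.ch * y.ce - x.ce * y.ch) := rfl
@[simp] lemma lie_ch (x y : SchrodingerAlgebra) :
    ⁅x, y⁆.ch = x.ce * y.cf - x.cf * y.ce := rfl
@[simp] lemma lie_cf (x y : SchrodingerAlgebra) :
    ⁅x, y⁆.cf = -2 * (x.ch * y.cf - x.cf * y.ch) := rfl
@[simp] lemma lie_cp (x y : SchrodingerAlgebra) :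
    ⁅x, y⁆.cp = (x.ch * y.cp - x.cp * y.ch) + (x.ce * y.cq - x.cq * y.ce) := rfl
@[simp] lemma lie_cq (x y : SchrodingerAlgebra) :
    ⁅x, y⁆.cq = -(x.ch * y.cq - x.cq * y.ch) - (x.cp * y.cf - x.cf * y.cp) := rfl
@[simp] lemma lie_cz (x y : SchrodingerAlgebra) :
    ⁅x, y⁆.cz = x.cp * y.cq - x.cq * y.cp := rfl

instance : AddCommGroup SchrodingerAlgebra where
  add_assoc x y w := by ext <;> simp <;> ring
  zero_add x := by ext <;> simp
  add_zero x := by ext <;> simp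
  neg_add_cancel x := by ext <;> simp
  add_comm x y := by ext <;> simp <;> ring
  nsmul := nsmulRec
  zsmul := zsmulRec

instance : Module ℂ SchrodingerAlgebra where
  one_smul x := by ext <;> simp
  mul_smul a b x := by ext <;> simp <;> ring
  smul_zero a := by ext <;> simp
  smul_add a x y := by ext <;> simp <;> ring
  add_smul a b x := by ext <;> simp <;> ring
  zero_smul x := by ext <;> simp

instance : LieRing SchrodingerAlgebra where
  add_lie x y w := by ext <;> simp <;> ring
  lie_add x y w := by ext <;> simp <;> ring
  lie_self x := by ext <;> simp <;> ring
  leibniz_lie x y w := by ext <;> simp <;> ring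

instance : LieAlgebra ℂ SchrodingerAlgebra where
  lie_smul c x y := by ext <;> simp <;> ring

/-- The basis element `e`. -/
def e : SchrodingerAlgebra := ⟨1, 0, 0, 0, 0, 0⟩
/-- The basis element `h`. -/
def h : SchrodingerAlgebra := ⟨0, 1, 0, 0, 0, 0⟩
/-- The basis element `f`. -/
def f : SchrodingerAlgebra := ⟨0, 0, 1, 0, 0, 0⟩
/-- The basis element `p`. -/
def p : SchrodingerAlgebra := ⟨0, 0, 0, 1, 0, 0⟩
/-- The basis element `q`. -/
def q : SchrodingerAlgebra := ⟨0, 0, 0, 0, 1, 0⟩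
/-- The basis element `z`. -/
def z : SchrodingerAlgebra := ⟨0, 0, 0, 0, 0, 1⟩

theorem bracket_table :
    ⁅h, e⁆ = (2 : ℂ) • e ∧ ⁅h, f⁆ = (-2 : ℂ) • f ∧ ⁅e, f⁆ = h ∧
    ⁅h, p⁆ = p ∧ ⁅h, q⁆ = -q ∧ ⁅p, q⁆ = z ∧
    ⁅e, q⁆ = p ∧ ⁅p, f⁆ = -q ∧ ⁅f, q⁆ = 0 ∧
    ⁅e, p⁆ = 0 ∧ ∀ x : SchrodingerAlgebra, ⁅z, x⁆ = 0 := by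
  refine ⟨?_, ?_, ?_, ?_, ?_, ?_, ?_, ?_, ?_, ?_, fun x => ?_⟩ <;>
    ext <;> simp [e, h, f, p, q, z]

/-- The Heisenberg subalgebra `ℋ = span_ℂ {p, q, z}`. -/
def heisenberg : LieSubalgebra ℂ SchrodingerAlgebra where
  toSubmodule := Submodule.span ℂ {p, q, z}
  lie_mem' := by
    intro x y hx hy
    obtain ⟨a, b, c, rfl⟩ := Submodule.mem_span_triple.1 hx
    obtain ⟨a', b', c', rfl⟩ := Submodule.mem_span_triple.1 hy
    refine Submodule.mem_span_triple.2 ⟨0, 0, a * b' - b * a', ?_⟩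
    ext <;> simp [p, q, z]
    ring

lemma p_mem_heisenberg : p ∈ heisenberg :=
  Submodule.subset_span (by simp)

lemma q_mem_heisenberg : q ∈ heisenberg :=
  Submodule.subset_span (by simp)

/-- `p` as an element of the Heisenberg subalgebra. -/
def pH : heisenberg := ⟨p, p_mem_heisenberg⟩
/-- `q` as an element of the Heisenberg subalgebra. -/
def qH : heisenberg := ⟨q, q_mem_heisenberg⟩

/-- The universal enveloping algebra `U(𝔖)`. -/
abbrev U : Type := UniversalEnvelopingAlgebra ℂ SchrodingerAlgebra

/-- The canonical map `𝔖 → U(𝔖)`. -/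
abbrev toU (x : SchrodingerAlgebra) : U := UniversalEnvelopingAlgebra.ι ℂ x

/-- `C₀ = p² f - q² e - h p q` in `U(𝔖)`. -/
def C₀ : U := toU p ^ 2 * toU f - toU q ^ 2 * toU e - toU h * toU p * toU q

/-- The subalgebra `ℂ[C₀]` of `U(𝔖)`. -/
abbrev polyC₀ : Subalgebra ℂ U := Algebra.adjoin ℂ {C₀}

/-- The element `d(C₀)` of `ℂ[C₀]`, for a polynomial `d`. -/
def evalC₀ (d : Polynomial ℂ) : polyC₀ :=
  ⟨Polynomial.aeval C₀ d, Polynomial.aeval_mem_adjoin_singleton ℂ C₀⟩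

section Modules

variable {V : Type*} [AddCommGroup V] [Module ℂ V] [LieRingModule SchrodingerAlgebra V]
  [LieModule ℂ SchrodingerAlgebra V]

/-- The action of `U(𝔖)` on an `𝔖`-module `V`, extending that of `𝔖`. -/
def act (u : U) (v : V) : V :=
  UniversalEnvelopingAlgebra.lift ℂ (LieModule.toEnd ℂ SchrodingerAlgebra V) u v

/-- `v` is a quasi-Whittaker vector of type `φ`, where `φ : ℋ → ℂ` is a Lie algebra homomorphism
(`LieCharacter ℂ ℋ` is the type of Lie algebra homomorphisms from `ℋ` to `ℂ`): it is nonzero and `x v = φ(x) v` for all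
`x ∈ ℋ`. -/
def IsQuasiWhittakerVector (φ : LieAlgebra.LieCharacter ℂ heisenberg) (v : V) : Prop :=
  v ≠ 0 ∧ ∀ x : heisenberg, ⁅(x : SchrodingerAlgebra), v⁆ = φ x • v

/-- `w` is a cyclic quasi-Whittaker vector of type `φ` of `V`, that is, a quasi-Whittaker vector
with `V = U(𝔖) w`; thus `V` is a quasi-Whittaker module of type `φ`. -/
def IsCyclicQuasiWhittakerVector (φ : LieAlgebra.LieCharacter ℂ heisenberg) (w : V) : Prop :=
  IsQuasiWhittakerVector φ w ∧ ∀ v : V, ∃ u : U, act u w = v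

/-- The left ideal `Ann_{U(𝔖)}(w) = {u ∈ U(𝔖) | u w = 0}` (`Ideal` means left ideal). -/
def annU (w : V) : Ideal U where
  carrier := {u | act u w = 0}
  add_mem' {a b} ha hb := by
    simp only [act, Set.mem_ofPred_eq, map_add, LinearMap.add_apply] at *
    rw [ha, hb, add_zero]
  zero_mem' := by simp [act]
  smul_mem' c u hu := by
    simp only [act, Set.mem_ofPred_eq, smul_eq_mul, map_mul, Module.End.mul_apply] at *
    rw [hu, map_zero]

/-- The ideal `Ann_{ℂ[C₀]}(w) = {a ∈ ℂ[C₀] | a w = 0}` of `ℂ[C₀]`. -/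
def annC₀ (w : V) : Ideal polyC₀ where
  carrier := {a | act (a : U) w = 0}
  add_mem' ha hb := (annU w).add_mem ha hb
  zero_mem' := (annU w).zero_mem
  smul_mem' c _ ha := (annU w).mul_mem_left (c : U) ha

end Modules

end

end SchrodingerAlgebra

/-! The annihilator of a cyclic quasi-Whittaker vector `w` of type `φ`.

Put `a = φ p` and `b = φ q`; since `φ` kills the bracket `z = ⁅p, q⁆`, the hypothesis `φ ≠ 0` says
that `a ≠ 0` or `b ≠ 0`. The central element `z` acts by zero on every module generated by such a
vector, and modulo `z` the element `C₀` is central (`IsReducedTuple.of_relations`). Moreover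
`C₀ w = (a² f - b² e - a b h) w` (`C₀_apply_vector`).

Let `I` be the left ideal on the right-hand side, and let first `a ≠ 0`. The formula for `C₀ w`
expresses `f w` through `C₀ w`, `e w` and `h w`, so that in `U(𝔖) ⧸ I` the subspace spanned by the
vectors `h ^ j e ^ i C₀ ^ k 1` is stable under `𝔖`. Every `u` is thus congruent modulo `I` to a sum
`∑ h ^ j e ^ i g_{ji}(C₀)` with polynomials `g_{ji}` (`exists_normalForm`). If `u w = 0`, then
`∑ h ^ j e ^ i v_{ji} = 0` in `V` with `v_{ji} = g_{ji}(C₀) w`, and every `v_{ji}` is an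
eigenvector of `p` and `q` with eigenvalues `a` and `b`. The operator `p - a` lowers the degree in
`h`, and on its kernel `q - b` lowers the degree in `e`, in both cases with leading factors that
are nonzero multiples of powers of `-a`; hence all `v_{ji}` vanish
(`eq_zero_of_sum_pow_apply_eq_zero`).
Therefore `g_{ji}(C₀)` lies in `Ann(w) ∩ ℂ[C₀]`, which is generated by `d(C₀)`, and `u ∈ I`. The
Poincaré–Birkhoff–Witt theorem is not needed.

If `b ≠ 0`, the same argument applies after the exchange `e ↔ f`, `h ↦ -h`, `p ↔ q`, which
preserves the relations (`IsReducedTuple.swap`). -/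

namespace SchrodingerAlgebra

noncomputable section

open Polynomial

attribute [local instance] LieRing.ofAssociativeRing

/-! ### The Schrödinger relations modulo `z` -/

/-- Elements `E, H, F, P, Q` of an associative ring that satisfy the relations of the quotient of
the Schrödinger algebra by its centre `ℂ z`, together with an element `C` commuting with them.
`C` plays the role of `C₀`; it is left unspecified because the exchange of `P` and `Q` changes the
sign of the expression for `C₀`. -/
structure IsReducedTuple {R : Type*} [Ring R] (E H F P Q C : R) : Prop where
  h_e : H * E = E * H + 2 * E
  h_f : H * F = F * H - 2 * F
  e_f : E * F = F * E + H
  h_p : H * P = P * H + P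
  h_q : H * Q = Q * H - Q
  p_q : P * Q = Q * P
  e_q : E * Q = Q * E + P
  f_p : F * P = P * F + Q
  f_q : F * Q = Q * F
  e_p : E * P = P * E
  comm_e : Commute C E
  comm_h : Commute C H
  comm_f : Commute C F
  comm_p : Commute C P
  comm_q : Commute C Q

/-- The relations are invariant under the exchange `E ↔ F`, `H ↦ -H`, `P ↔ Q`. -/
theorem IsReducedTuple.swap {R : Type*} [Ring R] {E H F P Q C : R}
    (t : IsReducedTuple E H F P Q C) : IsReducedTuple F (-H) E Q P C where
  h_e := by rw [neg_mul, t.h_f]; noncomm_ring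
  h_f := by rw [neg_mul, t.h_e]; noncomm_ring
  e_f := by rw [t.e_f]; abel
  h_p := by rw [neg_mul, t.h_q]; noncomm_ring
  h_q := by rw [neg_mul, t.h_p]; noncomm_ring
  p_q := t.p_q.symm
  e_q := t.f_p
  f_p := t.e_q
  f_q := t.e_p
  e_p := t.f_q
  comm_e := t.comm_f
  comm_h := t.comm_h.neg_right
  comm_f := t.comm_e
  comm_p := t.comm_q
  comm_q := t.comm_p

/-- If `P` and `Q` commute, then `P² F - Q² E - H P Q` commutes with all the generators. -/
theorem IsReducedTuple.of_relations {R : Type*} [Ring R] {E H F P Q : R}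
    (h_e : H * E = E * H + 2 * E) (h_f : H * F = F * H - 2 * F) (e_f : E * F = F * E + H)
    (h_p : H * P = P * H + P) (h_q : H * Q = Q * H - Q) (p_q : P * Q = Q * P)
    (e_q : E * Q = Q * E + P) (f_p : F * P = P * F + Q) (f_q : F * Q = Q * F)
    (e_p : E * P = P * E) :
    IsReducedTuple E H F P Q (P ^ 2 * F - Q ^ 2 * E - H * P * Q) := by
  -- With the following versions for longer words, the relations rewrite every word to an ordered
  -- one.
  have h_p' (X : R) : H * (P * X) = P * (H * X) + P * X := by
    rw [← mul_assoc, h_p]; noncomm_ring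
  have h_q' (X : R) : H * (Q * X) = Q * (H * X) - Q * X := by
    rw [← mul_assoc, h_q]; noncomm_ring
  have p_q' (X : R) : P * (Q * X) = Q * (P * X) := by
    rw [← mul_assoc, p_q, mul_assoc]
  have e_q' (X : R) : E * (Q * X) = Q * (E * X) + P * X := by
    rw [← mul_assoc, e_q]; noncomm_ring
  have f_p' (X : R) : F * (P * X) = P * (F * X) + Q * X := by
    rw [← mul_assoc, f_p]; noncomm_ring
  have f_q' (X : R) : F * (Q * X) = Q * (F * X) := by
    rw [← mul_assoc, f_q, mul_assoc]
  have e_p' (X : R) : E * (P * X) = P * (E * X) := by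
    rw [← mul_assoc, e_p, mul_assoc]
  refine ⟨h_e, h_f, e_f, h_p, h_q, p_q, e_q, f_p, f_q, e_p, ?_, ?_, ?_, ?_, ?_⟩ <;>
    simp only [Commute, SemiconjBy, pow_two, two_mul, mul_assoc, mul_add, mul_sub, add_mul,
      sub_mul, h_e, h_f, e_f, h_p, h_q, p_q, e_q, f_p, f_q, e_p, h_p', h_q', p_q', e_q', f_p',
      f_q', e_p'] <;> abel

/-! ### Ordered monomials span -/

section Span

variable {W : Type*} [AddCommGroup W] [Module ℂ W]

/-- The span of the vectors `H ^ j E ^ i C ^ k w`. -/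
def monomialSpan (H E C : Module.End ℂ W) (w : W) : Submodule ℂ W :=
  Submodule.span ℂ
    (Set.range fun n : ℕ × ℕ × ℕ => (H ^ n.1) ((E ^ n.2.1) ((C ^ n.2.2) w)))

variable {E H F P Q C : Module.End ℂ W} {w : W}

theorem monomial_mem_monomialSpan (H E C : Module.End ℂ W) (w : W) (j i k : ℕ) :
    (H ^ j) ((E ^ i) ((C ^ k) w)) ∈ monomialSpan H E C w :=
  Submodule.subset_span ⟨(j, i, k), rfl⟩

theorem apply_mem_monomialSpan {X : Module.End ℂ W}
    (hX : ∀ j i k, X ((H ^ j) ((E ^ i) ((C ^ k) w))) ∈ monomialSpan H E C w)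
    {y : W} (hy : y ∈ monomialSpan H E C w) : X y ∈ monomialSpan H E C w := by
  have : monomialSpan H E C w ≤ (monomialSpan H E C w).comap X :=
    Submodule.span_le.2 (by rintro _ ⟨n, rfl⟩; exact hX _ _ _)
  exact this hy

theorem h_apply_mem_monomialSpan {y : W} (hy : y ∈ monomialSpan H E C w) :
    H y ∈ monomialSpan H E C w :=
  apply_mem_monomialSpan (fun j i k => by
    rw [← Module.End.mul_apply, ← pow_succ']
    exact monomial_mem_monomialSpan H E C w (j + 1) i k) hy

theorem e_apply_mem_monomialSpan (h_e : H * E = E * H + 2 * E) {y : W}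
    (hy : y ∈ monomialSpan H E C w) : E y ∈ monomialSpan H E C w := by
  refine apply_mem_monomialSpan (fun j i k => ?_) hy
  induction j with
  | zero =>
    rw [pow_zero, Module.End.one_apply, ← Module.End.mul_apply, ← pow_succ']
    exact monomial_mem_monomialSpan H E C w 0 (i + 1) k
  | succ j ih =>
    have h_e' : E * H = H * E - (E + E) := by rw [h_e, two_mul]; abel
    rw [pow_succ', Module.End.mul_apply, ← Module.End.mul_apply, h_e']
    exact sub_mem (h_apply_mem_monomialSpan ih) (add_mem ih ih)

/-- To see that an operator preserves the span of the ordered monomials, it suffices to treat the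
vectors `C ^ k w` and to pass from `y` to `E y` and `H y`. -/
theorem apply_mem_monomialSpan_of_step {X : Module.End ℂ W}
    (hC : ∀ k, X ((C ^ k) w) ∈ monomialSpan H E C w)
    (hE : ∀ y ∈ monomialSpan H E C w, X y ∈ monomialSpan H E C w →
      X (E y) ∈ monomialSpan H E C w)
    (hH : ∀ y ∈ monomialSpan H E C w, X y ∈ monomialSpan H E C w →
      X (H y) ∈ monomialSpan H E C w)
    {y : W} (hy : y ∈ monomialSpan H E C w) : X y ∈ monomialSpan H E C w := by
  refine apply_mem_monomialSpan (fun j i k => ?_) hy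
  induction j with
  | zero =>
    rw [pow_zero, Module.End.one_apply]
    induction i with
    | zero => simpa using hC k
    | succ i ih =>
      rw [pow_succ', Module.End.mul_apply]
      exact hE _ (monomial_mem_monomialSpan H E C w 0 i k) ih
  | succ j ih =>
    rw [pow_succ', Module.End.mul_apply]
    exact hH _ (monomial_mem_monomialSpan H E C w j i k) ih

theorem commute_pow_apply {X Y : Module.End ℂ W} (hXY : Commute X Y) (k : ℕ) (y : W) :
    Y ((X ^ k) y) = (X ^ k) (Y y) := by
  rw [← Module.End.mul_apply, ← (hXY.pow_left k).eq, Module.End.mul_apply]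

theorem IsReducedTuple.p_apply_mem (t : IsReducedTuple E H F P Q C) {a : ℂ} (hP : P w = a • w)
    {y : W} (hy : y ∈ monomialSpan H E C w) : P y ∈ monomialSpan H E C w := by
  have h_p' : P * H = H * P - P := by rw [t.h_p]; abel
  refine apply_mem_monomialSpan_of_step (fun k => ?_) (fun y _ ih => ?_)
    (fun y _ ih => ?_) hy
  · rw [commute_pow_apply t.comm_p, hP, map_smul]
    exact Submodule.smul_mem _ _ (monomial_mem_monomialSpan H E C w 0 0 k)
  · rw [← Module.End.mul_apply, ← t.e_p]
    exact e_apply_mem_monomialSpan t.h_e ih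
  · rw [← Module.End.mul_apply, h_p']
    exact sub_mem (h_apply_mem_monomialSpan ih) ih

theorem IsReducedTuple.q_apply_mem (t : IsReducedTuple E H F P Q C) {a b : ℂ}
    (hP : P w = a • w) (hQ : Q w = b • w) {y : W} (hy : y ∈ monomialSpan H E C w) :
    Q y ∈ monomialSpan H E C w := by
  have h_q' : Q * H = H * Q + Q := by rw [t.h_q]; abel
  have e_q' : Q * E = E * Q - P := by rw [t.e_q]; abel
  refine apply_mem_monomialSpan_of_step (fun k => ?_) (fun y hy ih => ?_)
    (fun y _ ih => ?_) hy
  · rw [commute_pow_apply t.comm_q, hQ, map_smul]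
    exact Submodule.smul_mem _ _ (monomial_mem_monomialSpan H E C w 0 0 k)
  · rw [← Module.End.mul_apply, e_q']
    exact sub_mem (e_apply_mem_monomialSpan t.h_e ih) (t.p_apply_mem hP hy)
  · rw [← Module.End.mul_apply, h_q']
    exact add_mem (h_apply_mem_monomialSpan ih) ih

theorem IsReducedTuple.f_apply_mem (t : IsReducedTuple E H F P Q C) {α β γ : ℂ}
    (hF : F w = α • C w + β • E w + γ • H w) {y : W} (hy : y ∈ monomialSpan H E C w) :
    F y ∈ monomialSpan H E C w := by
  have h_f' : F * H = H * F + (F + F) := by rw [t.h_f, two_mul]; abel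
  have e_f' : F * E = E * F - H := by rw [t.e_f]; abel
  refine apply_mem_monomialSpan_of_step (fun k => ?_) (fun y hy ih => ?_)
    (fun y _ ih => ?_) hy
  · have hk : (C ^ k) w ∈ monomialSpan H E C w := monomial_mem_monomialSpan H E C w 0 0 k
    rw [commute_pow_apply t.comm_f, hF, map_add, map_add, map_smul, map_smul, map_smul,
      ← commute_pow_apply t.comm_e, ← commute_pow_apply t.comm_h, ← Module.End.mul_apply,
      ← pow_succ]
    exact add_mem (add_mem
      (Submodule.smul_mem _ _ (monomial_mem_monomialSpan H E C w 0 0 (k + 1)))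
      (Submodule.smul_mem _ _ (e_apply_mem_monomialSpan t.h_e hk)))
      (Submodule.smul_mem _ _ (h_apply_mem_monomialSpan hk))
  · rw [← Module.End.mul_apply, e_f']
    exact sub_mem (e_apply_mem_monomialSpan t.h_e ih) (h_apply_mem_monomialSpan hy)
  · rw [← Module.End.mul_apply, h_f']
    exact add_mem (h_apply_mem_monomialSpan ih) (add_mem ih ih)

end Span

/-! ### Independence by lowering operators -/

section Lowering

variable {W : Type*} [AddCommGroup W] [Module ℂ W] {D T P : Module.End ℂ W} {a : ℂ}

theorem pow_succ_mul_of_commutator {R : Type*} [Ring R] {D T P : R} (hDT : D * T = T * D - P)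
    (hDP : Commute D P) (m : ℕ) :
    D ^ (m + 1) * T = T * D ^ (m + 1) - (m + 1) • (P * D ^ m) := by
  induction m with
  | zero => simpa using hDT
  | succ m ih =>
    have hP : D * (P * D ^ m) = P * D ^ (m + 1) := by
      rw [← mul_assoc, hDP.eq, mul_assoc, pow_succ']
    rw [pow_succ' D (m + 1), mul_assoc, ih, mul_sub, ← mul_assoc, hDT, mul_smul_comm, hP,
      succ_nsmul _ (m + 1), sub_mul, mul_assoc]
    abel

/-- On an eigenvector `y` of `P` killed by `D`, the operator `D` lowers the degree in `T`. -/
theorem pow_apply_pow_apply (hDT : D * T = T * D - P) (hDP : Commute D P) {y : W}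
    (hD : D y = 0) (hP : P y = a • y) (j : ℕ) :
    (D ^ (j + 1)) ((T ^ j) y) = 0 ∧ (D ^ j) ((T ^ j) y) = ((-a) ^ j * (j.factorial : ℂ)) • y := by
  induction j with
  | zero => simpa using hD
  | succ j ih =>
    have key (m : ℕ) : (D ^ (m + 1)) ((T ^ (j + 1)) y) =
        T ((D ^ (m + 1)) ((T ^ j) y)) - (m + 1) • P ((D ^ m) ((T ^ j) y)) := by
      rw [pow_succ' T, Module.End.mul_apply, ← Module.End.mul_apply,
        pow_succ_mul_of_commutator hDT hDP]
      rfl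
    constructor
    · rw [key, pow_succ' D (j + 1), Module.End.mul_apply, ih.1]
      simp
    · rw [key, ih.1, ih.2, map_zero, map_smul, hP, ← Nat.cast_smul_eq_nsmul ℂ, smul_smul,
        smul_smul, zero_sub, ← neg_smul, Nat.factorial_succ]
      congr 1
      push_cast
      ring

theorem pow_apply_pow_apply_of_lt (hDT : D * T = T * D - P) (hDP : Commute D P) {y : W}
    (hD : D y = 0) (hP : P y = a • y) {j m : ℕ} (hjm : j < m) : (D ^ m) ((T ^ j) y) = 0 := by
  obtain ⟨k, rfl⟩ := Nat.exists_eq_add_of_lt hjm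
  rw [add_right_comm, add_comm, pow_add, Module.End.mul_apply,
    (pow_apply_pow_apply hDT hDP hD hP j).1, map_zero]

/-- Powers of `T` are independent over the vectors that `D` kills and on which `P` is a nonzero
scalar. -/
theorem eq_zero_of_sum_pow_apply_eq_zero (ha : a ≠ 0) (hDT : D * T = T * D - P)
    (hDP : Commute D P) {y : ℕ → W} (hD : ∀ j, D (y j) = 0) (hP : ∀ j, P (y j) = a • y j)
    (s : Finset ℕ) (hs : ∑ j ∈ s, (T ^ j) (y j) = 0) : ∀ j ∈ s, y j = 0 := by
  induction s using Finset.induction_on_max with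
  | empty => simp
  | insert n s hn ih =>
    have hns : n ∉ s := fun h => lt_irrefl _ (hn n h)
    rw [Finset.sum_insert hns] at hs
    have hyn : y n = 0 := by
      -- `D ^ n` kills all terms but the one of highest degree `n`.
      have h0 := congrArg (D ^ n) hs
      rw [map_add, map_zero, map_sum, Finset.sum_eq_zero fun j hj =>
        pow_apply_pow_apply_of_lt hDT hDP (hD j) (hP j) (hn j hj), add_zero,
        (pow_apply_pow_apply hDT hDP (hD n) (hP n) n).2] at h0
      refine (smul_eq_zero.1 h0).resolve_left (mul_ne_zero (pow_ne_zero _ (neg_ne_zero.2 ha)) ?_)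
      exact_mod_cast n.factorial_ne_zero
    rw [hyn, map_zero, zero_add] at hs
    intro j hj
    rcases Finset.mem_insert.1 hj with rfl | hj
    · exact hyn
    · exact ih hs j hj

end Lowering

/-! ### Normal forms -/

/-- The element `∑ x ^ j y ^ i g_{ji}(c)` of an algebra, for a finitely supported family of
polynomials `g`. -/
def normalForm {A : Type*} [Ring A] [Algebra ℂ A] (x y c : A) : (ℕ →₀ ℕ →₀ ℂ[X]) →ₗ[ℂ] A :=
  Finsupp.lsum ℂ fun j => LinearMap.mulLeft ℂ (x ^ j) ∘ₗ
    Finsupp.lsum ℂ fun i => LinearMap.mulLeft ℂ (y ^ i) ∘ₗ (aeval c).toLinearMap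

theorem normalForm_apply {A : Type*} [Ring A] [Algebra ℂ A] (x y c : A)
    (g : ℕ →₀ ℕ →₀ ℂ[X]) :
    normalForm x y c g =
      ∑ j ∈ g.support, x ^ j * ∑ i ∈ (g j).support, y ^ i * aeval c (g j i) := by
  simp only [normalForm, Finsupp.lsum_apply, Finsupp.sum, LinearMap.comp_apply,
    LinearMap.mulLeft_apply, AlgHom.toLinearMap_apply]

section NormalForm

variable {A V : Type*} [Ring A] [Algebra ℂ A] [AddCommGroup V] [Module ℂ V]
  (ρ : A →ₐ[ℂ] Module.End ℂ V) {w : V} {x y c : A} {F P Q : Module.End ℂ V} {a b : ℂ}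

/-- If a normal form annihilates a common eigenvector of `P` and `Q`, then so does each of its
coefficients. -/
theorem coeff_apply_eq_zero (t : IsReducedTuple (ρ y) (ρ x) F P Q (ρ c)) (ha : a ≠ 0)
    (hP : P w = a • w) (hQ : Q w = b • w) {g : ℕ →₀ ℕ →₀ ℂ[X]}
    (hg : ρ (normalForm x y c g) w = 0) (j i : ℕ) : ρ (aeval c (g j i)) w = 0 := by
  set v : ℕ → ℕ → V := fun j i => ρ (aeval c (g j i)) w with hv
  have comm {X : Module.End ℂ V} (hX : Commute (ρ c) X) (r : ℂ[X]) :
      Commute X (ρ (aeval c r)) := by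
    induction r using Polynomial.induction_on' with
    | add r s hr hs => simpa using hr.add_right hs
    | monomial n r =>
      rw [aeval_monomial, map_mul, map_pow, AlgHom.commutes]
      exact (Algebra.commute_algebraMap_right r X).mul_right (hX.symm.pow_right n)
  have eigen {X : Module.End ℂ V} (hX : Commute (ρ c) X) {s : ℂ} (hs : X w = s • w)
      (j i : ℕ) : X (v j i) = s • v j i := by
    rw [hv, ← Module.End.mul_apply, (comm hX _).eq, Module.End.mul_apply, hs, map_smul]
  have hDcomm {X Y : Module.End ℂ V} {s : ℂ} (h : Commute X Y) :
      Commute (X - algebraMap ℂ _ s) Y := h.sub_left (Algebra.commutes s Y)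
  have hDapply {X : Module.End ℂ V} {s : ℂ} {u : V} (h : X u = s • u) :
      (X - algebraMap ℂ _ s) u = 0 := by
    rw [LinearMap.sub_apply, h, Module.algebraMap_end_apply, sub_self]
  have hlower {X T : Module.End ℂ V} {s : ℂ} (h : T * X = X * T + P) :
      (X - algebraMap ℂ _ s) * T = T * (X - algebraMap ℂ _ s) - P := by
    rw [sub_mul, mul_sub, h, Algebra.commutes]; abel
  -- The inner sums are still eigenvectors of `P`, because `P` commutes with `ρ y`.
  have hPinner (j : ℕ) : P (∑ i ∈ (g j).support, (ρ y ^ i) (v j i)) =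
      a • ∑ i ∈ (g j).support, (ρ y ^ i) (v j i) := by
    rw [map_sum, Finset.smul_sum]
    refine Finset.sum_congr rfl fun i _ => ?_
    rw [commute_pow_apply t.e_p, eigen t.comm_p hP, map_smul]
  have hsum : ∑ j ∈ g.support, (ρ x ^ j) (∑ i ∈ (g j).support, (ρ y ^ i) (v j i)) = 0 := by
    simpa [normalForm_apply, hv, LinearMap.sum_apply] using hg
  by_cases hj : j ∈ g.support
  · have hinner := eq_zero_of_sum_pow_apply_eq_zero ha (hlower t.h_p) (hDcomm (Commute.refl P))
      (fun j => hDapply (hPinner j)) hPinner _ hsum j hj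
    by_cases hi : i ∈ (g j).support
    · exact eq_zero_of_sum_pow_apply_eq_zero ha (hlower t.e_q)
        (hDcomm (show Commute Q P from t.p_q.symm)) (fun i => hDapply (eigen t.comm_q hQ j i))
        (eigen t.comm_p hP j) _ hinner i hi
    · simp [Finsupp.notMem_support_iff.1 hi]
  · simp [Finsupp.notMem_support_iff.1 hj]

end NormalForm

/-! ### Cyclic modules over `U(𝔖)` -/

theorem toU_mul (x y : SchrodingerAlgebra) : toU x * toU y = toU y * toU x + toU ⁅x, y⁆ := by
  have hxy : toU ⁅x, y⁆ = toU x * toU y - toU y * toU x := LieHom.map_lie _ x y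
  rw [hxy]; abel

theorem toU_zero : toU 0 = 0 := map_zero _

theorem toU_neg (x : SchrodingerAlgebra) : toU (-x) = -toU x := map_neg _ x

theorem toU_smul (s : ℂ) (x : SchrodingerAlgebra) : toU (s • x) = s • toU x := map_smul _ s x

/-- A subalgebra of `U(𝔖)` containing `e, h, f, p, q` is everything; `z = ⁅p, q⁆` comes for free. -/
theorem subalgebra_eq_top {S : Subalgebra ℂ U} (he : toU e ∈ S) (hh : toU h ∈ S)
    (hf : toU f ∈ S) (hp : toU p ∈ S) (hq : toU q ∈ S) : S = ⊤ := by
  have hz : toU z ∈ S := by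
    have := toU_mul p q
    rw [bracket_table.2.2.2.2.2.1] at this
    rw [eq_sub_of_add_eq' this.symm]
    exact sub_mem (mul_mem hp hq) (mul_mem hq hp)
  have hS (x : SchrodingerAlgebra) : toU x ∈ S := by
    have hx : x = x.ce • e + x.ch • h + x.cf • f + x.cp • p + x.cq • q + x.cz • z := by
      ext <;> simp [e, h, f, p, q, z]
    rw [hx]
    simp only [toU, map_add, map_smul]
    exact add_mem (add_mem (add_mem (add_mem (add_mem (S.smul_mem he _) (S.smul_mem hh _))
      (S.smul_mem hf _)) (S.smul_mem hp _)) (S.smul_mem hq _)) (S.smul_mem hz _)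
  let j : SchrodingerAlgebra →ₗ⁅ℂ⁆ S :=
    { toFun := fun x => ⟨toU x, hS x⟩
      map_add' := fun x y => Subtype.ext (map_add _ x y)
      map_smul' := fun s x => Subtype.ext (map_smul _ s x)
      map_lie' := fun {x y} => Subtype.ext (LieHom.map_lie _ x y) }
  have hj : S.val.comp (UniversalEnvelopingAlgebra.lift ℂ j) = AlgHom.id ℂ U := by
    ext x
    change S.val (UniversalEnvelopingAlgebra.lift ℂ j (UniversalEnvelopingAlgebra.ι ℂ x)) = _
    rw [UniversalEnvelopingAlgebra.lift_ι_apply]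
    rfl
  refine eq_top_iff.2 fun u _ => ?_
  rw [← AlgHom.id_apply (R := ℂ) u, ← hj]
  exact (UniversalEnvelopingAlgebra.lift ℂ j u).2

theorem toU_z_commute (u : U) : Commute (toU z) u := by
  have hz (x : SchrodingerAlgebra) : toU x ∈ Subalgebra.centralizer ℂ {toU z} := by
    rw [Subalgebra.mem_centralizer_iff]
    rintro _ rfl
    rw [toU_mul, bracket_table.2.2.2.2.2.2.2.2.2.2, toU_zero, add_zero]
  have hu : u ∈ Subalgebra.centralizer ℂ {toU z} := by
    rw [subalgebra_eq_top (hz e) (hz h) (hz f) (hz p) (hz q)]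
    trivial
  exact (Subalgebra.mem_centralizer_iff ℂ).1 hu _ rfl

section Cyclic

variable {W : Type*} [AddCommGroup W] [Module ℂ W] {ρ : U →ₐ[ℂ] Module.End ℂ W} {w : W}
  {a b : ℂ}

/-- On a module generated by a common eigenvector of `p` and `q`, the element `z` acts by zero and
`C₀` commutes with `U(𝔖)`. -/
theorem isReducedTuple_of_cyclic (hcyc : ∀ v, ∃ u, ρ u w = v) (hp : ρ (toU p) w = a • w)
    (hq : ρ (toU q) w = b • w) :
    IsReducedTuple (ρ (toU e)) (ρ (toU h)) (ρ (toU f)) (ρ (toU p)) (ρ (toU q)) (ρ C₀) := by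
  obtain ⟨hhe, hhf, hef, hhp, hhq, hpq, heq, hpf, hfq, hep, -⟩ := bracket_table
  have rel {x y r : SchrodingerAlgebra} (hxy : ⁅x, y⁆ = r) :
      ρ (toU x) * ρ (toU y) = ρ (toU y) * ρ (toU x) + ρ (toU r) := by
    rw [← map_mul, toU_mul, hxy, map_add, map_mul]
  have hz : ρ (toU z) = 0 := by
    have hzw : ρ (toU z) w = 0 := by
      have := LinearMap.congr_fun (rel hpq) w
      simp only [Module.End.mul_apply, LinearMap.add_apply, hp, hq, map_smul] at this
      rwa [smul_comm, left_eq_add] at this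
    ext v
    obtain ⟨u, rfl⟩ := hcyc v
    rw [← Module.End.mul_apply, ← map_mul, (toU_z_commute u).eq, map_mul, Module.End.mul_apply,
      hzw, map_zero, LinearMap.zero_apply]
  have hC : ρ C₀ = ρ (toU p) ^ 2 * ρ (toU f) - ρ (toU q) ^ 2 * ρ (toU e)
      - ρ (toU h) * ρ (toU p) * ρ (toU q) := by
    simp [C₀]
  rw [hC]
  refine .of_relations ?_ ?_ (rel hef) (rel hhp) ?_ ?_ (rel heq) ?_ ?_ ?_
  · rw [rel hhe, toU_smul, map_smul, two_mul, two_smul]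
  · rw [rel hhf, toU_smul, map_smul, two_mul, neg_smul, two_smul, sub_eq_add_neg]
  · rw [rel hhq, toU_neg, map_neg, sub_eq_add_neg]
  · rw [rel hpq, hz, add_zero]
  · rw [rel hpf, toU_neg, map_neg, neg_add_cancel_right]
  · rw [rel hfq, toU_zero, map_zero, add_zero]
  · rw [rel hep, toU_zero, map_zero, add_zero]

/-- The action of `C₀` on a common eigenvector of `p` and `q`. -/
theorem C₀_apply_vector (hcyc : ∀ v, ∃ u, ρ u w = v) (hp : ρ (toU p) w = a • w)
    (hq : ρ (toU q) w = b • w) :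
    ρ C₀ w = a ^ 2 • ρ (toU f) w - b ^ 2 • ρ (toU e) w - (a * b) • ρ (toU h) w := by
  have t := isReducedTuple_of_cyclic hcyc hp hq
  have hpf : ρ (toU p) (ρ (toU f) w) = a • ρ (toU f) w - b • w := by
    have := LinearMap.congr_fun t.f_p w
    simp only [Module.End.mul_apply, LinearMap.add_apply, hp, hq, map_smul] at this
    rw [this, add_sub_cancel_right]
  have hqe : ρ (toU q) (ρ (toU e) w) = b • ρ (toU e) w - a • w := by
    have := LinearMap.congr_fun t.e_q w
    simp only [Module.End.mul_apply, LinearMap.add_apply, hp, hq, map_smul] at this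
    rw [this, add_sub_cancel_right]
  simp only [C₀, map_sub, map_mul, pow_two, LinearMap.sub_apply, Module.End.mul_apply,
    hp, hq, hpf, hqe, map_smul]
  module

end Cyclic

/-- If `p - a` and `q - b` lie in the left ideal `I`, then modulo `I` every element of `U(𝔖)` has a
normal form, in `h, e, C₀` if `a ≠ 0` and in `-h, f, C₀` if `b ≠ 0`. -/
theorem exists_normalForm {I : Ideal U} {a b : ℂ} (hp : toU p - algebraMap ℂ U a ∈ I)
    (hq : toU q - algebraMap ℂ U b ∈ I) :
    (a ≠ 0 → ∀ u, ∃ g, u - normalForm (toU h) (toU e) C₀ g ∈ I) ∧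
    (b ≠ 0 → ∀ u, ∃ g, u - normalForm (-toU h) (toU f) C₀ g ∈ I) := by
  let ρ : U →ₐ[ℂ] Module.End ℂ (U ⧸ I) := Algebra.lsmul ℂ ℂ (U ⧸ I)
  let w : U ⧸ I := Submodule.Quotient.mk 1
  have hρ (u : U) : ρ u w = Submodule.Quotient.mk u := by
    change u • (Submodule.Quotient.mk 1 : U ⧸ I) = _
    rw [← Submodule.Quotient.mk_smul, smul_eq_mul, mul_one]
  have hcyc (v : U ⧸ I) : ∃ u, ρ u w = v := by
    obtain ⟨u, rfl⟩ := Submodule.Quotient.mk_surjective I v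
    exact ⟨u, hρ u⟩
  have scalar {x : U} {s : ℂ} (hx : x - algebraMap ℂ U s ∈ I) : ρ x w = s • w := by
    rw [hρ, (Submodule.Quotient.eq I).2 hx, ← hρ, AlgHom.commutes, Module.algebraMap_end_apply]
  have t := isReducedTuple_of_cyclic hcyc (scalar hp) (scalar hq)
  have hC := C₀_apply_vector hcyc (scalar hp) (scalar hq)
  have main {x y : U} (hmem : ∀ u, ρ u w ∈ monomialSpan (ρ x) (ρ y) (ρ C₀) w) (u : U) :
      ∃ g, u - normalForm x y C₀ g ∈ I := by
    have hle : monomialSpan (ρ x) (ρ y) (ρ C₀) w ≤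
        LinearMap.range ((LinearMap.toSpanSingleton U (U ⧸ I) w).restrictScalars ℂ ∘ₗ
          normalForm x y C₀) := by
      refine Submodule.span_le.2 ?_
      rintro _ ⟨⟨j, i, k⟩, rfl⟩
      refine ⟨Finsupp.single j (Finsupp.single i (X ^ k)), ?_⟩
      have hg : normalForm x y C₀ (Finsupp.single j (Finsupp.single i (X ^ k))) =
          x ^ j * (y ^ i * C₀ ^ k) := by simp [normalForm]
      simp only [← Module.End.mul_apply, ← map_pow, ← map_mul]
      rw [LinearMap.comp_apply, hg]
      rfl
    obtain ⟨g, hg⟩ := hle (hmem u)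
    refine ⟨g, (Submodule.Quotient.eq I).1 ?_⟩
    rw [← hρ, ← hρ, ← hg]
    rfl
  have generate {N : Submodule ℂ (U ⧸ I)} (hw : w ∈ N) (he : ∀ v ∈ N, ρ (toU e) v ∈ N)
      (hh : ∀ v ∈ N, ρ (toU h) v ∈ N) (hf : ∀ v ∈ N, ρ (toU f) v ∈ N)
      (hp : ∀ v ∈ N, ρ (toU p) v ∈ N) (hq : ∀ v ∈ N, ρ (toU q) v ∈ N) (u : U) : ρ u w ∈ N := by
    let S : Subalgebra ℂ U :=
      { carrier := {u | ∀ v ∈ N, ρ u v ∈ N}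
        mul_mem' := fun {x y} hx hy v hv => by
          rw [map_mul]; exact hx _ (hy v hv)
        add_mem' := fun {x y} hx hy v hv => by
          rw [map_add]; exact add_mem (hx v hv) (hy v hv)
        algebraMap_mem' := fun s v hv => by
          rw [AlgHom.commutes]; exact N.smul_mem s hv }
    have hS : S = ⊤ := subalgebra_eq_top he hh hf hp hq
    exact (hS ▸ Algebra.mem_top : u ∈ S) w hw
  constructor
  · intro ha
    have hF : ρ (toU f) w = (a ^ 2)⁻¹ • ρ C₀ w + ((a ^ 2)⁻¹ * b ^ 2) • ρ (toU e) w
        + ((a ^ 2)⁻¹ * (a * b)) • ρ (toU h) w := by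
      rw [mul_smul, mul_smul, ← smul_add, ← smul_add, eq_inv_smul_iff₀ (pow_ne_zero 2 ha), hC]
      abel
    exact main (generate (monomial_mem_monomialSpan _ _ _ w 0 0 0)
      (fun v => e_apply_mem_monomialSpan t.h_e) (fun v => h_apply_mem_monomialSpan)
      (fun v => t.f_apply_mem hF) (fun v => t.p_apply_mem (scalar hp))
      (fun v => t.q_apply_mem (scalar hp) (scalar hq)))
  · intro hb
    have hE : ρ (toU e) w = (-(b ^ 2)⁻¹) • ρ C₀ w + ((b ^ 2)⁻¹ * a ^ 2) • ρ (toU f) w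
        + ((b ^ 2)⁻¹ * (a * b)) • (-ρ (toU h)) w := by
      rw [neg_smul, ← smul_neg, mul_smul, mul_smul, ← smul_add, ← smul_add,
        eq_inv_smul_iff₀ (pow_ne_zero 2 hb), hC, LinearMap.neg_apply, smul_neg]
      abel
    have t' := t.swap
    refine main (x := -toU h) (y := toU f) ?_
    rw [map_neg]
    exact generate (monomial_mem_monomialSpan _ _ _ w 0 0 0)
      (fun v => t'.f_apply_mem hE)
      (fun v hv => by simpa using neg_mem (h_apply_mem_monomialSpan hv))
      (fun v => e_apply_mem_monomialSpan t'.h_e)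
      (fun v => t'.q_apply_mem (scalar hq) (scalar hp)) (fun v => t'.p_apply_mem (scalar hq))

/-! ### The annihilator -/

theorem normalForm_mem {I : Ideal U} {x y c : U} {g : ℕ →₀ ℕ →₀ ℂ[X]}
    (hg : ∀ j i, aeval c (g j i) ∈ I) : normalForm x y c g ∈ I := by
  rw [normalForm_apply]
  exact sum_mem fun j _ => I.mul_mem_left _ (sum_mem fun i _ => I.mul_mem_left _ (hg j i))

/-- A nonzero character of the Heisenberg subalgebra, which vanishes on `z = ⁅p, q⁆`, is nonzero
on `p` or on `q`. -/
theorem character_apply_ne_zero {φ : LieAlgebra.LieCharacter ℂ heisenberg} (hφ : φ ≠ 0) :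
    φ pH ≠ 0 ∨ φ qH ≠ 0 := by
  by_contra! hcon
  refine hφ (LieHom.ext fun ⟨x, hx⟩ => ?_)
  obtain ⟨r, s, k, rfl⟩ := Submodule.mem_span_triple.1 hx
  have : (⟨r • p + s • q + k • z, hx⟩ : heisenberg) = r • pH + s • qH + k • ⁅pH, qH⁆ := by
    apply Subtype.ext
    change _ = r • p + s • q + k • ⁅p, q⁆
    rw [bracket_table.2.2.2.2.2.1]
  rw [this, map_add, map_add, map_smul, map_smul, map_smul, hcon.1, hcon.2,
    LieAlgebra.lieCharacter_apply_lie]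
  simp

end

end SchrodingerAlgebra

open SchrodingerAlgebra

theorem corollary5p3 {V : Type*} [AddCommGroup V] [Module ℂ V]
    [LieRingModule SchrodingerAlgebra V] [LieModule ℂ SchrodingerAlgebra V]
    (φ : LieAlgebra.LieCharacter ℂ SchrodingerAlgebra.heisenberg) (hφ : φ ≠ 0)
    (w : V) (hw : SchrodingerAlgebra.IsCyclicQuasiWhittakerVector φ w)
    (hann : SchrodingerAlgebra.annC₀ w ≠ ⊥)
    (d : Polynomial ℂ) (hd : d.Monic)
    (hgen : SchrodingerAlgebra.annC₀ w = Ideal.span {SchrodingerAlgebra.evalC₀ d}) :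
    SchrodingerAlgebra.annU w =
      Ideal.span {(SchrodingerAlgebra.evalC₀ d : SchrodingerAlgebra.U)} ⊔
      Ideal.span {SchrodingerAlgebra.toU SchrodingerAlgebra.p -
        algebraMap ℂ SchrodingerAlgebra.U (φ SchrodingerAlgebra.pH)} ⊔
      Ideal.span {SchrodingerAlgebra.toU SchrodingerAlgebra.q -
        algebraMap ℂ SchrodingerAlgebra.U (φ SchrodingerAlgebra.qH)} := by
  set a := φ pH
  set b := φ qH
  set I : Ideal U := Ideal.span {(evalC₀ d : U)} ⊔ Ideal.span {toU p - algebraMap ℂ U a} ⊔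
    Ideal.span {toU q - algebraMap ℂ U b} with hI
  let ρ : U →ₐ[ℂ] Module.End ℂ V :=
    UniversalEnvelopingAlgebra.lift ℂ (LieModule.toEnd ℂ SchrodingerAlgebra V)
  have hact (x : SchrodingerAlgebra) : ρ (toU x) w = ⁅x, w⁆ := by
    simp only [ρ, toU]
    rw [UniversalEnvelopingAlgebra.lift_ι_apply, LieModule.toEnd_apply_apply]
  have hp : ρ (toU p) w = a • w := (hact p).trans (hw.1.2 pH)
  have hq : ρ (toU q) w = b • w := (hact q).trans (hw.1.2 qH)
  have hdI : (evalC₀ d : U) ∈ I :=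
    Submodule.mem_sup_left (Submodule.mem_sup_left (Ideal.mem_span_singleton_self _))
  have hpI : toU p - algebraMap ℂ U a ∈ I :=
    Submodule.mem_sup_left (Submodule.mem_sup_right (Ideal.mem_span_singleton_self _))
  have hqI : toU q - algebraMap ℂ U b ∈ I :=
    Submodule.mem_sup_right (Ideal.mem_span_singleton_self _)
  have scalar {x : U} {s : ℂ} (hx : ρ x w = s • w) : x - algebraMap ℂ U s ∈ annU w := by
    change ρ _ w = 0
    rw [map_sub, LinearMap.sub_apply, hx, AlgHom.commutes, Module.algebraMap_end_apply, sub_self]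
  have hIann : I ≤ annU w := by
    refine sup_le (sup_le ?_ ?_) ?_ <;> rw [Ideal.span_singleton_le_iff_mem]
    · have : evalC₀ d ∈ annC₀ w := hgen ▸ Ideal.mem_span_singleton_self _
      exact this
    · exact scalar hp
    · exact scalar hq
  have hpoly (r : Polynomial ℂ) (hr : ρ (Polynomial.aeval C₀ r) w = 0) :
      Polynomial.aeval C₀ r ∈ I := by
    have hmem : evalC₀ r ∈ annC₀ w := hr
    rw [hgen] at hmem
    obtain ⟨s, hs⟩ := Submodule.mem_span_singleton.1 hmem
    have hs' : (s : U) * (evalC₀ d : U) = Polynomial.aeval C₀ r := congrArg Subtype.val hs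
    exact hs' ▸ I.mul_mem_left _ hdI
  -- Normal forms and their independence turn an annihilating `u` into coefficients in `Ann(w) ∩ ℂ[C₀]`.
  have reduce {x y : U} (hnf : ∀ u, ∃ g, u - normalForm x y C₀ g ∈ I)
      (hcoeff : ∀ g, ρ (normalForm x y C₀ g) w = 0 →
        ∀ j i, ρ (Polynomial.aeval C₀ (g j i)) w = 0) : annU w ≤ I := by
    intro u hu
    obtain ⟨g, hg⟩ := hnf u
    have hgw : normalForm x y C₀ g ∈ annU w := by
      simpa using sub_mem hu (hIann hg)
    have hgI : normalForm x y C₀ g ∈ I :=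
      normalForm_mem fun j i => hpoly _ (hcoeff g hgw j i)
    simpa using add_mem hg hgI
  have t := isReducedTuple_of_cyclic (ρ := ρ) hw.2 hp hq
  refine le_antisymm ?_ hIann
  rcases character_apply_ne_zero hφ with ha | hb
  · exact reduce ((exists_normalForm hpI hqI).1 ha)
      fun g hg => coeff_apply_eq_zero ρ t ha hp hq hg
  · have t' := t.swap
    rw [← map_neg] at t'
    exact reduce ((exists_normalForm hpI hqI).2 hb)
      fun g hg => coeff_apply_eq_zero ρ t' hb hq hp hg
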